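/- Let $n\ge 0$, let $\mathbb{B}^n=\{z\in\mathbb{C}^n:|z|<1\}$ be the open Euclidean unit ball and let $\phi=(\phi_1,\dots,\phi_n):\mathbb{B}^n\to\mathbb{B}^n$ be analytic with $\phi(0)=0$ and with $\phi'(0)=\left(\partial\phi_i/\partial z_j(0)\right)_{i,j}$ a non-singular matrix. Suppose that $\phi$ is not unitary on any slice, that is, there are no unit vectors $\zeta,\eta\in\mathbb{C}^n$ with $\phi(t\zeta)=t\eta$ for all $t\in\mathbb{C}$ with $|t|<1$. Let $F=(F_1,\dots,F_n)^t$ with $F_i=\sum_{\alpha\in\mathbb{N}_0^n}c_{i,\alpha}z^\alpha\in\mathbb{C}[[z_1,\dots,z_n]]$ be a column of formal power series satisfying Schroeder's equation $C_\phi F=\phi'(0)F$ formally, that is, $$F_i(\phi_1,\dots,\phi_n)=\sum_{j=1}^n\frac{\partial\phi_i}{\partial z_j}(0)\,F_j\qquad(1\le i\le n)$$ in $\mathbb{C}[[z_1,\dots,z_n]]$, where the left-hand side is obtained by substituting the Taylor series of $\phi_1,\dots,\phi_n$ at $0$ for the variables of $F_i$. Then $F$ is analytic on $\mathbb{B}^n$: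 for every $i$ and every $z\in\mathbb{B}^n$ the series $\sum_\alpha c_{i,\alpha}z^\alpha$ converges absolutely, and its sum $f_i(z)$ defines an analytic map $f=(f_1,\dots,f_n):\mathbb{B}^n\to\mathbb{C}^n$. -/

import Mathlib

/-- The Taylor series at `0` of a function `g` on `ℂⁿ`, as a formal power series in `z₁, …, zₙ`:
with `k = |α|`, its coefficient at `α` is the coefficient of `z ^ α` in the homogeneous polynomial
`(1 / k!) • Dᵏg(0)(z, …, z)`, where `z = ∑ j, z j • e_j` is expanded by multilinearity: the sum runs
over the words `w` of length `k` in the letters `1, …, n` in which each letter `j` occurs exactly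
`α j` times. -/
noncomputable def taylorSeriesAtZero {n : ℕ} (g : EuclideanSpace ℂ (Fin n) → ℂ) :
    MvPowerSeries (Fin n) ℂ :=
  fun α => ((Nat.factorial α.degree : ℕ) : ℂ)⁻¹ *
    ∑ w : Fin α.degree → Fin n with (∑ l, Finsupp.single (w l) 1) = α,
      iteratedFDeriv ℂ α.degree g 0 (fun l => EuclideanSpace.single (w l) (1 : ℂ))

/-- The matrix `φ'(0)` of first partial derivatives `∂φ_i / ∂z_j` at `0`. -/
noncomputable def jacobianAtZero {n : ℕ}
    (φ : EuclideanSpace ℂ (Fin n) → EuclideanSpace ℂ (Fin n)) : Matrix (Fin n) (Fin n) ℂ :=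
  Matrix.of fun i j => fderiv ℂ φ 0 (EuclideanSpace.single j (1 : ℂ)) i

/-- `φ` is unitary on the slice `{t ζ : |t| < 1}` of the unit ball, `ζ` a unit vector, if
there is a unit vector `η` with `φ (t ζ) = t η` for all `|t| < 1`. -/
def IsUnitaryOnSlice {n : ℕ} (φ : EuclideanSpace ℂ (Fin n) → EuclideanSpace ℂ (Fin n))
    (ζ : EuclideanSpace ℂ (Fin n)) : Prop :=
  ‖ζ‖ = 1 ∧ ∃ η : EuclideanSpace ℂ (Fin n), ‖η‖ = 1 ∧
    ∀ t : ℂ, ‖t‖ < 1 → φ (t • ζ) = t • η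

/-- `F = (F₁, …, Fₙ)ᵗ` is a formal power series solution of Schroeder's equation
`C_φ F = φ'(0) F`: in the ring of formal power series, substituting the Taylor series
of `φ₁, …, φₙ` for the variables in `F_i` gives the `i`-th entry of `φ'(0) F`, for each `i`. The
substitution is the genuine one (each coefficient is a finite sum) as soon as `φ 0 = 0`. -/
def IsFormalSchroederSolution {n : ℕ}
    (φ : EuclideanSpace ℂ (Fin n) → EuclideanSpace ℂ (Fin n))
    (F : Fin n → MvPowerSeries (Fin n) ℂ) : Prop :=
  ∀ i, MvPowerSeries.subst (fun j => taylorSeriesAtZero (fun z => φ z j)) (F i) =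
    ∑ j, jacobianAtZero φ i j • F j

open Filter Topology Asymptotics

/-! Fix `r < 1`. Since no slice is unitary, Schwarz's lemma is strict; with compactness and a second
use of Schwarz it gives `‖φ z‖ ≤ c * ‖z‖` with `c < 1` on the ball of radius `r`
(`exists_norm_le_mul_norm_of_not_isUnitaryOnSlice`). Put `A = φ'(0)`, `B = A⁻¹`, and let `P_N` be
`F` truncated below degree `N`. The formal equation says `P_N ∘ φ - A P_N = O(‖z‖ ^ N)`. Once `‖B‖ *
c ^ N ≤ 1 / 2`, the Koenigs limit of `B ^ k ∘ P_N ∘ φ^[k]` exists and differs from `P_N` by `O(‖z‖ ^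
N)`. It does not depend on `N`, so a single function `f` has `F` as its asymptotic expansion at `0`
(`exists_linearization`).

This forces `F` to converge. The limit `f` is bounded, and holomorphic on complex lines through `0`,
so Cauchy's estimates bound every homogeneous component of `F` by one constant on the ball.
Averaging over tori gives the same bound for single monomials, and a dilation by `σ > 1` turns it
into a geometric majorant (`HasExpansion.hasSum_of_slices`). Finally, a power series converging on a
ball has an analytic sum there (`analyticOnNhd_ball_of_hasSum`). -/

/-! ### Asymptotic expansions at the origin. -/

theorem norm_prod_pow_le {n : ℕ} (z : EuclideanSpace ℂ (Fin n)) (α : Fin n →₀ ℕ) :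
    ‖∏ j, z j ^ α j‖ ≤ ‖z‖ ^ α.degree := by
  rw [norm_prod, Finsupp.degree_eq_sum, ← Finset.prod_pow_eq_pow_sum]
  exact Finset.prod_le_prod (fun _ _ => norm_nonneg _) fun j _ => by
    rw [norm_pow]; exact pow_le_pow_left₀ (norm_nonneg _) (PiLp.norm_apply_le z j) _

theorem isBigO_norm_pow_of_le {E : Type*} [NormedAddCommGroup E] {M N : ℕ} (h : M ≤ N) :
    (fun z : E => ‖z‖ ^ N) =O[𝓝 0] fun z => ‖z‖ ^ M := by
  refine IsBigO.of_bound 1 ?_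
  filter_upwards [Metric.ball_mem_nhds (0 : E) one_pos] with z hz
  rw [mem_ball_zero_iff] at hz
  simpa using pow_le_pow_of_le_one (norm_nonneg z) hz.le h

theorem MvPolynomial.isBigO_eval {n N : ℕ} (P : MvPolynomial (Fin n) ℂ)
    (hP : ∀ α : Fin n →₀ ℕ, α.degree < N → P.coeff α = 0) :
    (fun z : EuclideanSpace ℂ (Fin n) => MvPolynomial.eval z.ofLp P) =O[𝓝 0]
      fun z => ‖z‖ ^ N := by
  simp only [MvPolynomial.eval_eq']
  refine IsBigO.fun_sum fun α hα => ?_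
  have hN : N ≤ α.degree := by
    by_contra! h
    exact (MvPolynomial.mem_support_iff.1 hα) (hP α h)
  refine IsBigO.trans ?_ (isBigO_norm_pow_of_le hN)
  refine IsBigO.of_bound ‖P.coeff α‖ (Eventually.of_forall fun z => ?_)
  rw [norm_mul, norm_pow, norm_norm]
  gcongr
  exact norm_prod_pow_le z α

/-- `g` has the asymptotic expansion `s` at `0`: the truncation of `s` below degree `N`
approximates `g` up to `O(‖z‖ ^ N)`, for all `N`. -/
def HasExpansion {n : ℕ} (g : EuclideanSpace ℂ (Fin n) → ℂ) (s : MvPowerSeries (Fin n) ℂ) : Prop :=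
  ∀ N : ℕ, (fun z => g z - MvPolynomial.eval z.ofLp (s.truncTotal N)) =O[𝓝 0] fun z => ‖z‖ ^ N

namespace HasExpansion

variable {n : ℕ} {g h : EuclideanSpace ℂ (Fin n) → ℂ} {s t : MvPowerSeries (Fin n) ℂ}

theorem of_polynomial (P : MvPolynomial (Fin n) ℂ) :
    HasExpansion (fun z => MvPolynomial.eval z.ofLp P) P := fun N => by
  simp only [← map_sub]
  refine MvPolynomial.isBigO_eval _ fun α hα => ?_
  rw [MvPolynomial.coeff_sub, MvPowerSeries.coeff_truncTotal _ hα]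
  simp

theorem const (c : ℂ) : HasExpansion (n := n) (fun _ => c) (MvPowerSeries.C c) := by
  simpa using of_polynomial (n := n) (MvPolynomial.C c)

theorem add (hg : HasExpansion g s) (hh : HasExpansion h t) :
    HasExpansion (fun z => g z + h z) (s + t) := fun N => by
  refine ((hg N).add (hh N)).congr_left fun z => ?_
  simp only [map_add]
  ring

theorem isBigO_one (hg : HasExpansion g s) :
    g =O[𝓝 0] fun _ : EuclideanSpace ℂ (Fin n) => (1 : ℝ) := by
  have h0 : s.truncTotal 0 = 0 := by
    ext α
    simp [MvPowerSeries.coeff_truncTotal_eq_zero]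
  simpa [h0] using hg 0

theorem mul (hg : HasExpansion g s) (hh : HasExpansion h t) :
    HasExpansion (fun z => g z * h z) (s * t) := fun N => by
  have h1 := (hg N).mul hh.isBigO_one
  have h2 := ((of_polynomial (s.truncTotal N)).isBigO_one).mul (hh N)
  -- Coefficients of a product below degree `N` depend only on the factors' coefficients below
  -- degree `N`.
  have h3 := MvPolynomial.isBigO_eval (N := N)
    (s.truncTotal N * t.truncTotal N - (s * t).truncTotal N) fun α hα => by
      rw [MvPolynomial.coeff_sub, MvPowerSeries.coeff_truncTotal_mul_truncTotal_eq_coeff_mul _ _ hα,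
        MvPowerSeries.coeff_truncTotal _ hα, sub_self]
  simp only [mul_one, one_mul] at h1 h2
  refine ((h1.add h2).add h3).congr_left fun z => ?_
  simp only [map_sub, map_mul]
  ring

theorem aeval {g : Fin n → EuclideanSpace ℂ (Fin n) → ℂ} {s : Fin n → MvPowerSeries (Fin n) ℂ}
    (hg : ∀ j, HasExpansion (g j) (s j)) (P : MvPolynomial (Fin n) ℂ) :
    HasExpansion (fun z => MvPolynomial.eval (fun j => g j z) P) (MvPolynomial.aeval s P) := by
  induction P using MvPolynomial.induction_on with
  | C c => simpa [MvPowerSeries.algebraMap_apply] using const c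
  | add p q hp hq => simpa using hp.add hq
  | mul_X p j hp => simpa using hp.mul (hg j)

theorem isBigO_of_coeff_eq_zero (hg : HasExpansion g s) {N : ℕ}
    (hs : ∀ α : Fin n →₀ ℕ, α.degree < N → s.coeff α = 0) : g =O[𝓝 0] fun z => ‖z‖ ^ N := by
  have h0 : s.truncTotal N = 0 := by
    ext α
    simp only [MvPowerSeries.coeff_truncTotal_eq_ite, MvPolynomial.coeff_zero, ite_eq_right_iff]
    exact hs α
  simpa [h0] using hg N

end HasExpansion

/-! ### Substitution, Taylor series and truncated Schroeder equations. -/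

/-- Each `a j` has order at least one, so monomials of degree `≥ N` contribute nothing below degree
`N`. This reduces formal substitution to polynomial composition, which `HasExpansion.aeval` handles.
-/
theorem MvPowerSeries.coeff_subst_eq_coeff_aeval_truncTotal {n N : ℕ}
    {a : Fin n → MvPowerSeries (Fin n) ℂ} (ha : ∀ j, (a j).constantCoeff = 0)
    (F : MvPowerSeries (Fin n) ℂ) {α : Fin n →₀ ℕ} (hα : α.degree < N) :
    (MvPowerSeries.subst a F).coeff α = (MvPolynomial.aeval a (F.truncTotal N)).coeff α := by
  have hs := MvPowerSeries.hasSubst_of_constantCoeff_zero ha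
  rw [← MvPowerSeries.subst_coe (R := ℂ), coeff_subst hs, coeff_subst hs]
  congr 1 with d
  by_cases hd : d.degree < N
  · rw [MvPolynomial.coeff_coe, coeff_truncTotal _ hd]
  · have h1 : (d.degree : ℕ∞) ≤ (d.prod fun s e => a s ^ e).order := by
      refine le_trans ?_ (le_order_prod _ _)
      rw [Finsupp.degree_apply]
      push_cast
      exact Finset.sum_le_sum fun j _ => le_order_pow_of_constantCoeff_eq_zero _ (ha j)
    rw [coeff_of_lt_order (lt_of_lt_of_le (by exact_mod_cast (by omega)) h1), smul_zero, smul_zero]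

/-- The value at `x` of the homogeneous component of degree `m` of the power series `s`. -/
noncomputable def MvPowerSeries.homogeneousEval {n : ℕ} (s : MvPowerSeries (Fin n) ℂ) (m : ℕ)
    (x : Fin n → ℂ) : ℂ :=
  ∑ α ∈ Finset.finsuppAntidiag Finset.univ m, s.coeff α * ∏ j, x j ^ α j

theorem mem_finsuppAntidiag_univ {n m : ℕ} {α : Fin n →₀ ℕ} :
    α ∈ Finset.finsuppAntidiag Finset.univ m ↔ α.degree = m := by
  simp [Finset.mem_finsuppAntidiag, Finsupp.degree_eq_sum]

theorem MvPowerSeries.eval_truncTotal {n : ℕ} (s : MvPowerSeries (Fin n) ℂ) (N : ℕ)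
    (x : Fin n → ℂ) :
    MvPolynomial.eval x (s.truncTotal N) = ∑ m ∈ Finset.range N, s.homogeneousEval m x := by
  have h : s.truncTotal N = ∑ m ∈ Finset.range N, ∑ α ∈ Finset.finsuppAntidiag Finset.univ m,
      MvPolynomial.monomial α (s.coeff α) := by
    ext β
    simp only [MvPolynomial.coeff_sum, MvPolynomial.coeff_monomial, coeff_truncTotal_eq_ite,
      Finset.sum_ite_eq', mem_finsuppAntidiag_univ, Finset.sum_ite_eq, Finset.mem_range]
  rw [h]
  simp only [map_sum, homogeneousEval, MvPolynomial.eval_monomial]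
  refine Finset.sum_congr rfl fun m _ => Finset.sum_congr rfl fun α _ => ?_
  rw [Finsupp.prod_fintype _ _ (by simp)]

theorem coeff_taylorSeriesAtZero {n m : ℕ} (g : EuclideanSpace ℂ (Fin n) → ℂ) {α : Fin n →₀ ℕ}
    (hα : α.degree = m) :
    (taylorSeriesAtZero g).coeff α = ((Nat.factorial m : ℕ) : ℂ)⁻¹ *
      ∑ w : Fin m → Fin n with (∑ l, Finsupp.single (w l) 1) = α,
        iteratedFDeriv ℂ m g 0 (fun l => EuclideanSpace.single (w l) (1 : ℂ)) := by
  subst hα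
  rfl

/-- Multilinear expansion produces a sum over words; grouping words by their letter counts produces
the coefficients. -/
theorem homogeneousEval_taylorSeriesAtZero {n m : ℕ} (g : EuclideanSpace ℂ (Fin n) → ℂ)
    (z : EuclideanSpace ℂ (Fin n)) :
    (taylorSeriesAtZero g).homogeneousEval m z.ofLp =
      ((Nat.factorial m : ℕ) : ℂ)⁻¹ * iteratedFDeriv ℂ m g 0 (fun _ => z) := by
  have hz : z = ∑ j, z.ofLp j • EuclideanSpace.single j (1 : ℂ) := by
    ext i
    simp [Pi.single_apply]
  have hdeg (w : Fin m → Fin n) : (∑ l, Finsupp.single (w l) 1 : Fin n →₀ ℕ).degree = m := by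
    simp
  have hD : iteratedFDeriv ℂ m g 0 (fun _ => z) = ∑ w : Fin m → Fin n,
      (∏ l, z.ofLp (w l)) * iteratedFDeriv ℂ m g 0
        (fun l => EuclideanSpace.single (w l) (1 : ℂ)) := by
    conv_lhs => rw [hz]
    rw [ContinuousMultilinearMap.map_sum]
    refine Finset.sum_congr rfl fun w _ => ?_
    rw [ContinuousMultilinearMap.map_smul_univ, smul_eq_mul]
  rw [hD, ← Finset.sum_fiberwise_of_maps_to (s := Finset.univ)
    (t := Finset.finsuppAntidiag Finset.univ m)
    (g := fun w : Fin m → Fin n => ∑ l, Finsupp.single (w l) 1)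
    (fun w _ => mem_finsuppAntidiag_univ.2 (hdeg w)), MvPowerSeries.homogeneousEval, Finset.mul_sum]
  refine Finset.sum_congr rfl fun α hα => ?_
  rw [coeff_taylorSeriesAtZero g (mem_finsuppAntidiag_univ.1 hα), mul_assoc, Finset.sum_mul]
  congr 1
  refine Finset.sum_congr rfl fun w hw => ?_
  rw [mul_comm]
  congr 1
  rw [Finset.mem_filter] at hw
  have (j : Fin n) : α j = ∑ l, if w l = j then 1 else 0 := by
    rw [← hw.2, Finsupp.finsetSum_apply]
    simp [Finsupp.single_apply]
  simp only [this, ← Finset.prod_pow_eq_pow_sum]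
  rw [Finset.prod_comm]
  simp [pow_ite]

theorem AnalyticAt.hasExpansion {n : ℕ} {g : EuclideanSpace ℂ (Fin n) → ℂ}
    (hg : AnalyticAt ℂ g 0) : HasExpansion g (taylorSeriesAtZero g) := by
  obtain ⟨p, r, hp⟩ := hg
  intro N
  refine (hp.hasFPowerSeriesAt.isBigO_sub_partialSum_pow N).congr_left fun z => ?_
  rw [zero_add, MvPowerSeries.eval_truncTotal, FormalMultilinearSeries.partialSum]
  congr 1
  refine Finset.sum_congr rfl fun m _ => ?_
  rw [homogeneousEval_taylorSeriesAtZero, ← hp.factorial_smul, nsmul_eq_mul,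
    inv_mul_cancel_left₀ (by exact_mod_cast m.factorial_ne_zero)]

theorem constantCoeff_taylorSeriesAtZero {n : ℕ} (g : EuclideanSpace ℂ (Fin n) → ℂ) :
    (taylorSeriesAtZero g).constantCoeff = g 0 := by
  have := coeff_taylorSeriesAtZero g (α := 0) (m := 0) (by simp)
  simpa using this

/-- Truncations of a formal solution of Schroeder's equation are approximate solutions. -/
theorem IsFormalSchroederSolution.isBigO {n : ℕ}
    {φ : EuclideanSpace ℂ (Fin n) → EuclideanSpace ℂ (Fin n)} (hφ : AnalyticAt ℂ φ 0)
    (hzero : φ 0 = 0) {F : Fin n → MvPowerSeries (Fin n) ℂ} (hF : IsFormalSchroederSolution φ F)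
    (N : ℕ) (i : Fin n) :
    (fun z => MvPolynomial.eval (φ z).ofLp ((F i).truncTotal N) -
      ∑ j, jacobianAtZero φ i j * MvPolynomial.eval z.ofLp ((F j).truncTotal N)) =O[𝓝 0]
        fun z => ‖z‖ ^ N := by
  have hφj (j : Fin n) : AnalyticAt ℂ (fun z => φ z j) 0 :=
    ((EuclideanSpace.proj j : EuclideanSpace ℂ (Fin n) →L[ℂ] ℂ).analyticAt _).comp hφ
  have h1 := HasExpansion.aeval (fun j => (hφj j).hasExpansion) ((F i).truncTotal N)
  have h2 := HasExpansion.of_polynomial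
    (-∑ j, MvPolynomial.C (jacobianAtZero φ i j) * (F j).truncTotal N)
  refine ((h1.add h2).isBigO_of_coeff_eq_zero (N := N) fun α hα => ?_).congr_left fun z => ?_
  · rw [map_add, ← MvPowerSeries.coeff_subst_eq_coeff_aeval_truncTotal _ _ hα, hF i]
    · simp [MvPowerSeries.coeff_truncTotal _ hα, MvPolynomial.coeff_sum, MvPolynomial.coeff_C_mul]
    · intro j
      rw [constantCoeff_taylorSeriesAtZero, hzero]
      rfl
  · simp [sub_eq_add_neg]

/-! ### Schwarz lemma and uniform contraction. -/

/-- Strict Schwarz lemma for self-maps of the unit ball that are not unitary on any slice. -/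
theorem norm_lt_norm_of_not_isUnitaryOnSlice {n : ℕ}
    {φ : EuclideanSpace ℂ (Fin n) → EuclideanSpace ℂ (Fin n)}
    (hφ : DifferentiableOn ℂ φ (Metric.ball 0 1))
    (hmaps : Set.MapsTo φ (Metric.ball 0 1) (Metric.ball 0 1)) (hzero : φ 0 = 0)
    (hslice : ∀ ζ, ¬ IsUnitaryOnSlice φ ζ) {z : EuclideanSpace ℂ (Fin n)} (hz0 : z ≠ 0)
    (hz : ‖z‖ < 1) : ‖φ z‖ < ‖z‖ := by
  have hmaps' := hmaps.mono_right Metric.ball_subset_closedBall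
  refine lt_of_le_of_ne (Complex.norm_le_norm_of_mapsTo_ball hφ hmaps' hzero hz) fun heq => ?_
  have hnz : ‖z‖ ≠ 0 := norm_ne_zero_iff.2 hz0
  set ζ : EuclideanSpace ℂ (Fin n) := ((‖z‖ : ℂ)⁻¹) • z with hζ
  have hζ1 : ‖ζ‖ = 1 := by
    rw [hζ, norm_smul, norm_inv, Complex.norm_real, norm_norm, inv_mul_cancel₀ hnz]
  have hzζ : (‖z‖ : ℂ) • ζ = z := by
    rw [hζ, smul_smul, mul_inv_cancel₀ (by exact_mod_cast hnz), one_smul]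
  have hmem (t : ℂ) (ht : t ∈ Metric.ball (0 : ℂ) 1) :
      t • ζ ∈ Metric.ball (0 : EuclideanSpace ℂ (Fin n)) 1 := by
    rw [mem_ball_zero_iff] at ht ⊢
    rwa [norm_smul, hζ1, mul_one]
  -- At `t = ‖z‖` the difference quotient of `t ↦ φ (t • ζ)` has norm one, the equality case of
  -- Schwarz; the map is then linear on the whole disc.
  obtain ⟨η, hη1, hη⟩ := Complex.affine_of_mapsTo_ball_of_exists_norm_dslope_eq_div'
    (f := fun t : ℂ => φ (t • ζ)) (c := 0) (R₁ := 1) (R₂ := 1)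
    (hφ.comp (Differentiable.differentiableOn (by fun_prop)) hmem)
    (fun t ht => by simpa [hzero] using (hmaps' (hmem t ht)))
    ⟨(‖z‖ : ℂ), by simpa using hz, by
      rw [dslope_of_ne _ (by exact_mod_cast hnz), slope_def_module]
      simp only [hzζ, zero_smul, hzero, sub_zero]
      rw [norm_smul, heq, norm_inv, Complex.norm_real, norm_norm, inv_mul_cancel₀ hnz, div_one]⟩
  refine hslice ζ ⟨hζ1, η, by simpa using hη1, fun t ht => ?_⟩
  simpa [hzero] using hη (by simpa using ht : t ∈ Metric.ball (0 : ℂ) 1)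

/-- The maximum of `‖φ‖` on the closed ball of radius `r` is attained, hence is `< r` by the strict
inequality. Schwarz's lemma between balls of these two radii makes their ratio a contraction
constant. -/
theorem exists_norm_le_mul_norm_of_not_isUnitaryOnSlice {n : ℕ}
    {φ : EuclideanSpace ℂ (Fin n) → EuclideanSpace ℂ (Fin n)}
    (hφ : DifferentiableOn ℂ φ (Metric.ball 0 1))
    (hmaps : Set.MapsTo φ (Metric.ball 0 1) (Metric.ball 0 1)) (hzero : φ 0 = 0)
    (hslice : ∀ ζ, ¬ IsUnitaryOnSlice φ ζ) {r : ℝ} (hr0 : 0 < r) (hr1 : r < 1) :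
    ∃ c : ℝ, 0 ≤ c ∧ c < 1 ∧ ∀ z ∈ Metric.ball 0 r, ‖φ z‖ ≤ c * ‖z‖ := by
  have hsub : Metric.closedBall (0 : EuclideanSpace ℂ (Fin n)) r ⊆ Metric.ball 0 1 :=
    Metric.closedBall_subset_ball hr1
  obtain ⟨w, hw, hmax⟩ := (isCompact_closedBall (0 : EuclideanSpace ℂ (Fin n)) r).exists_isMaxOn
    ⟨0, by simpa using hr0.le⟩ (hφ.continuousOn.mono hsub).norm
  have hwr : ‖φ w‖ < r := by
    rcases eq_or_ne w 0 with rfl | hw0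
    · simpa [hzero] using hr0
    · rw [mem_closedBall_zero_iff] at hw
      exact (norm_lt_norm_of_not_isUnitaryOnSlice hφ hmaps hzero hslice hw0
        (hw.trans_lt hr1)).trans_le hw
  refine ⟨‖φ w‖ / r, by positivity, (div_lt_one hr0).2 hwr, fun z hz => ?_⟩
  have := Complex.dist_le_div_mul_dist_of_mapsTo_ball (f := φ) (c := 0) (R₁ := r) (R₂ := ‖φ w‖)
    (hφ.mono (Metric.ball_subset_closedBall.trans hsub))
    (fun x hx => by
      rw [hzero, mem_closedBall_zero_iff]
      exact hmax (Metric.ball_subset_closedBall hx)) hz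
  simpa [hzero] using this

/-! ### Koenigs linearization of an approximate solution. -/

section Linearization

variable {E W : Type*} [NormedAddCommGroup E] [NormedAddCommGroup W] {φ : E → E} {r c : ℝ}

theorem iterate_mem_ball_of_contracting (hc0 : 0 ≤ c) (hc1 : c < 1)
    (hc : ∀ z ∈ Metric.ball (0 : E) r, ‖φ z‖ ≤ c * ‖z‖) (k : ℕ) {z : E}
    (hz : z ∈ Metric.ball (0 : E) r) :
    φ^[k] z ∈ Metric.ball (0 : E) r ∧ ‖φ^[k] z‖ ≤ c ^ k * ‖z‖ := by
  induction k with
  | zero => simpa using hz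
  | succ k ih =>
    have h1 := hc _ ih.1
    rw [Function.iterate_succ_apply']
    constructor
    · rw [mem_ball_zero_iff] at *
      nlinarith [norm_nonneg (φ^[k] z), ih.1]
    · calc _ ≤ c * (c ^ k * ‖z‖) := h1.trans (mul_le_mul_of_nonneg_left ih.2 hc0)
        _ = _ := by ring

variable [NormedSpace ℂ E] [NormedSpace ℂ W]

theorem DifferentiableOn.iterate_ball_of_contracting (hφ : DifferentiableOn ℂ φ (Metric.ball 0 r))
    (hc0 : 0 ≤ c) (hc1 : c < 1) (hc : ∀ z ∈ Metric.ball (0 : E) r, ‖φ z‖ ≤ c * ‖z‖) (k : ℕ) :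
    DifferentiableOn ℂ (φ^[k]) (Metric.ball 0 r) := by
  induction k with
  | zero => simpa using differentiableOn_id
  | succ k ih =>
    rw [Function.iterate_succ']
    exact hφ.comp ih fun z hz => (iterate_mem_ball_of_contracting hc0 hc1 hc k hz).1

variable [FiniteDimensional ℂ E] [CompleteSpace W]

/-- The defect of an approximate solution `P` of `P ∘ φ = A ∘ P` is summed along the orbits. -/
theorem exists_tendsto_linearization (hr : 0 < r) (hφ : DifferentiableOn ℂ φ (Metric.ball 0 r))
    (hc0 : 0 ≤ c) (hc1 : c < 1) (hc : ∀ z ∈ Metric.ball (0 : E) r, ‖φ z‖ ≤ c * ‖z‖)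
    {A B : W →L[ℂ] W} (hBA : ∀ w, B (A w) = w) {P : E → W} (hP : Differentiable ℂ P) {N : ℕ}
    (hN : N ≠ 0) (hE : (fun z => P (φ z) - A (P z)) =O[𝓝 0] fun z => ‖z‖ ^ N)
    (hB : ‖B‖ * c ^ N ≤ 1 / 2) :
    ∃ f : E → W, (∃ C, ∀ z ∈ Metric.ball (0 : E) r, ‖f z‖ ≤ C) ∧
      (∀ z, DifferentiableOn ℂ (fun t : ℂ => f (t • z)) {t | t • z ∈ Metric.ball (0 : E) r}) ∧
      (fun z => f z - P z) =O[𝓝 0] (fun z => ‖z‖ ^ N) ∧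
      ∀ z ∈ Metric.ball (0 : E) r,
        Tendsto (fun k => (B ^ k) (P (φ^[k] z))) atTop (𝓝 (f z)) := by
  obtain ⟨m, rfl⟩ : ∃ m, N = m + 1 := Nat.exists_eq_succ_of_ne_zero hN
  set D : E → W := fun z => P (φ z) - A (P z) with hD
  have : ProperSpace E := FiniteDimensional.proper ℂ E
  obtain ⟨K, hK⟩ := (isCompact_closedBall (0 : E) r).exists_bound_of_continuousOn
    hP.continuous.continuousOn
  have hsub := Metric.ball_subset_closedBall (x := (0 : E)) (ε := r)
  have hφmem (z) (hz : z ∈ Metric.ball (0 : E) r) : φ z ∈ Metric.ball (0 : E) r :=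
    (iterate_mem_ball_of_contracting hc0 hc1 hc 1 hz).1
  have hDdiff : DifferentiableOn ℂ D (Metric.ball 0 r) :=
    (hP.comp_differentiableOn hφ).sub (A.differentiable.comp hP).differentiableOn
  have hK0 : 0 ≤ K := (norm_nonneg _).trans (hK 0 (by simpa using hr.le))
  set M : ℝ := K + ‖A‖ * K with hM
  have hM0 : 0 ≤ M := by positivity
  have hDM (z) (hz : z ∈ Metric.ball (0 : E) r) : ‖D z‖ ≤ M :=
    (norm_sub_le _ _).trans (add_le_add (hK _ (hsub (hφmem z hz)))
      ((A.le_opNorm _).trans (by gcongr; exact hK _ (hsub hz))))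
  have hD0 : D 0 = 0 :=
    IsBigO.eq_zero_of_norm_pow (x₀ := 0) (n := m + 1) (by simpa using hE) m.succ_ne_zero
  -- Schwarz's lemma of order `m + 1` upgrades the bound near `0` to an explicit one on the whole
  -- ball.
  have hDle (z) (hz : z ∈ Metric.ball (0 : E) r) : ‖D z‖ ≤ M * (‖z‖ / r) ^ (m + 1) := by
    have := Complex.dist_le_mul_div_pow_of_mapsTo_ball_of_isLittleO (f := D) (c := 0) (R₂ := M)
      (n := m) hDdiff (fun x hx => by simpa [hD0] using hDM x hx)
      (by
        simp only [hD0, sub_zero]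
        exact hE.trans_isLittleO (by simpa using! (isLittleO_pow_pow (𝕜 := ℝ)
          (Nat.lt_succ_self m)).comp_tendsto (tendsto_norm_zero (E := E)))) hz
    simpa [hD0] using this
  -- These are the increments of `B ^ k (P (φ^[k] z))`, because `B` is a left inverse of `A`.
  set T : ℕ → E → W := fun k z => (B ^ (k + 1)) (D (φ^[k] z)) with hT
  set L : ℝ := ‖B‖ * M / r ^ (m + 1) with hL
  have hTle (k : ℕ) (z) (hz : z ∈ Metric.ball (0 : E) r) :
      ‖T k z‖ ≤ L * ‖z‖ ^ (m + 1) * (1 / 2) ^ k := by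
    obtain ⟨h1, h2⟩ := iterate_mem_ball_of_contracting hc0 hc1 hc k hz
    calc ‖T k z‖ ≤ ‖B‖ ^ (k + 1) * (M * ((c ^ k * ‖z‖) / r) ^ (m + 1)) := by
          refine (ContinuousLinearMap.le_opNorm _ _).trans ?_
          refine mul_le_mul (norm_pow_le' _ k.succ_pos) ((hDle _ h1).trans ?_) (norm_nonneg _)
            (by positivity)
          gcongr
      _ = L * ‖z‖ ^ (m + 1) * (‖B‖ * c ^ (m + 1)) ^ k := by
          rw [hL, div_pow, mul_pow, mul_pow, ← pow_mul, ← pow_mul, mul_comm k]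
          ring
      _ ≤ _ := by gcongr
  have hTle' (k : ℕ) (z) (hz : z ∈ Metric.ball (0 : E) r) :
      ‖T k z‖ ≤ L * r ^ (m + 1) * (1 / 2) ^ k := by
    refine (hTle k z hz).trans ?_
    rw [mem_ball_zero_iff] at hz
    gcongr
  have hgeom (a : ℝ) : HasSum (fun k : ℕ => a * (1 / 2) ^ k) (a * 2) :=
    hasSum_geometric_two.mul_left a
  have hTsum (z) (hz : z ∈ Metric.ball (0 : E) r) : Summable fun k => T k z :=
    Summable.of_norm_bounded (hgeom _).summable fun k => hTle k z hz
  have hTtsum (z) (hz : z ∈ Metric.ball (0 : E) r) :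
      ‖∑' k, T k z‖ ≤ L * ‖z‖ ^ (m + 1) * 2 :=
    tsum_of_norm_bounded (hgeom _) fun k => hTle k z hz
  have hTd (k : ℕ) : DifferentiableOn ℂ (T k) (Metric.ball 0 r) :=
    (B ^ (k + 1)).differentiable.comp_differentiableOn
      (hDdiff.comp (hφ.iterate_ball_of_contracting hc0 hc1 hc k)
        fun z hz => (iterate_mem_ball_of_contracting hc0 hc1 hc k hz).1)
  refine ⟨fun z => P z + ∑' k, T k z, ⟨K + L * r ^ (m + 1) * 2, fun z hz => ?_⟩, fun z => ?_, ?_,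
    fun z hz => ?_⟩
  · refine (norm_add_le _ _).trans (add_le_add (hK _ (hsub hz)) ((hTtsum z hz).trans ?_))
    rw [mem_ball_zero_iff] at hz
    gcongr
  · have hd : Differentiable ℂ fun t : ℂ => t • z := by fun_prop
    refine (hP.comp hd).differentiableOn.add ?_
    exact Complex.differentiableOn_tsum_of_summable_norm (hgeom _).summable
      (F := fun k t => T k (t • z)) (fun k => (hTd k).comp hd.differentiableOn fun t ht => ht)
      (Metric.isOpen_ball.preimage hd.continuous) fun k t ht => hTle' k _ ht
  · refine IsBigO.of_bound (L * 2) ?_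
    filter_upwards [Metric.ball_mem_nhds (0 : E) hr] with z hz
    rw [add_sub_cancel_left, norm_pow, norm_norm]
    exact (hTtsum z hz).trans_eq (by ring)
  · refine ((hTsum z hz).hasSum.tendsto_sum_nat.const_add (P z)).congr fun k => ?_
    have hstep (k : ℕ) :
        T k z = (B ^ (k + 1)) (P (φ^[k + 1] z)) - (B ^ k) (P (φ^[k] z)) := by
      simp only [hT, hD, map_sub, Function.iterate_succ_apply']
      congr 1
      rw [pow_succ, mul_apply_eq_comp, hBA]
    simp only [hstep]
    rw [Finset.sum_range_sub (fun k => (B ^ k) (P (φ^[k] z)))]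
    simp

/-- One `N` controls the limit only to order `N`. The limits for `N ≥ N₀` agree because `P N - P N₀
= O(‖z‖ ^ N₀)` decays along orbits faster than `B ^ k` can grow. -/
theorem exists_linearization (hr : 0 < r) (hφ : DifferentiableOn ℂ φ (Metric.ball 0 r))
    (hc0 : 0 ≤ c) (hc1 : c < 1) (hc : ∀ z ∈ Metric.ball (0 : E) r, ‖φ z‖ ≤ c * ‖z‖)
    {A B : W →L[ℂ] W} (hBA : ∀ w, B (A w) = w) {P : ℕ → E → W}
    (hP : ∀ N, Differentiable ℂ (P N))
    (hE : ∀ N, (fun z => P N (φ z) - A (P N z)) =O[𝓝 0] fun z => ‖z‖ ^ N)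
    (hPP : ∀ M N, M ≤ N → (fun z => P N z - P M z) =O[𝓝 0] fun z => ‖z‖ ^ M) :
    ∃ f : E → W, (∃ C, ∀ z ∈ Metric.ball (0 : E) r, ‖f z‖ ≤ C) ∧
      (∀ z, DifferentiableOn ℂ (fun t : ℂ => f (t • z)) {t | t • z ∈ Metric.ball (0 : E) r}) ∧
      ∀ N, (fun z => f z - P N z) =O[𝓝 0] (fun z => ‖z‖ ^ N) := by
  have hlim : Tendsto (fun N : ℕ => ‖B‖ * c ^ N) atTop (𝓝 0) := by
    simpa using (tendsto_pow_atTop_nhds_zero_of_lt_one hc0 hc1).const_mul ‖B‖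
  -- Requiring `N₀ ≠ 0` makes the defect vanish at the origin.
  obtain ⟨N₀, hN₀⟩ := eventually_atTop.1
    ((hlim.eventually_le_const (by norm_num : (0 : ℝ) < 1 / 2)).and (eventually_ne_atTop 0))
  obtain ⟨f, hfb, hfd, hf0, hft⟩ := exists_tendsto_linearization hr hφ hc0 hc1 hc hBA (hP N₀)
    (hN₀ N₀ le_rfl).2 (hE N₀) (hN₀ N₀ le_rfl).1
  refine ⟨f, hfb, hfd, fun N => ?_⟩
  rcases le_total N N₀ with hN | hN
  · refine ((hf0.trans (isBigO_norm_pow_of_le hN)).add (hPP N N₀ hN)).congr_left fun z => ?_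
    abel
  · obtain ⟨g, -, -, hg0, hgt⟩ := exists_tendsto_linearization hr hφ hc0 hc1 hc hBA (hP N)
      (hN₀ N hN).2 (hE N) (hN₀ N hN).1
    refine hg0.congr' ?_ EventuallyEq.rfl
    filter_upwards [Metric.ball_mem_nhds (0 : E) hr] with z hz
    suffices h : g z - f z = 0 by rw [sub_eq_zero.1 h]
    refine tendsto_nhds_unique ((hgt z hz).sub (hft z hz)) ?_
    simp only [← map_sub]
    obtain ⟨C, hC0, hC⟩ := (hPP N₀ N hN).exists_pos
    have hck : Tendsto (fun k : ℕ => c ^ k * ‖z‖) atTop (𝓝 0) := by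
      simpa using (tendsto_pow_atTop_nhds_zero_of_lt_one hc0 hc1).mul_const ‖z‖
    have horb : Tendsto (fun k => φ^[k] z) atTop (𝓝 0) :=
      squeeze_zero_norm (fun k => (iterate_mem_ball_of_contracting hc0 hc1 hc k hz).2) hck
    have hgeom : Tendsto (fun k : ℕ => C * ‖z‖ ^ N₀ * (1 / 2 : ℝ) ^ k) atTop (𝓝 0) := by
      simpa using (tendsto_pow_atTop_nhds_zero_of_lt_one (r := (1 / 2 : ℝ)) (by norm_num)
        (by norm_num)).const_mul (C * ‖z‖ ^ N₀)
    refine squeeze_zero_norm' ?_ hgeom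
    filter_upwards [horb.eventually hC.bound, eventually_ge_atTop 1] with k hk hk1
    calc _ ≤ ‖B‖ ^ k * (C * (c ^ k * ‖z‖) ^ N₀) := by
          refine (ContinuousLinearMap.le_opNorm _ _).trans ?_
          refine mul_le_mul (norm_pow_le' _ hk1) (hk.trans ?_) (norm_nonneg _) (by positivity)
          rw [norm_pow, norm_norm]
          gcongr
          exact (iterate_mem_ball_of_contracting hc0 hc1 hc k hz).2
      _ = C * ‖z‖ ^ N₀ * (‖B‖ * c ^ N₀) ^ k := by
          rw [mul_pow, mul_pow, ← pow_mul, ← pow_mul, mul_comm k]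
          ring
      _ ≤ _ := by
          gcongr
          exact (hN₀ N₀ le_rfl).1

end Linearization

/-! ### From asymptotic expansions to absolutely convergent series. -/

theorem eq_zero_of_mul_pow_isBigO {a : ℂ} {k : ℕ}
    (h : (fun t : ℂ => a * t ^ k) =O[𝓝 0] fun t => ‖t‖ ^ (k + 1)) : a = 0 := by
  have := IsBigO.continuousMultilinearMap_apply_eq_zero (n := k)
    (p := ContinuousMultilinearMap.mkPiRing ℂ (Fin k) a)
    (h.congr_left fun t => by simp [mul_comm]) 1
  simpa using this

/-- A function holomorphic on a closed disk and bounded by `M` there, with an asymptotic expansion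
`∑ b k * t ^ k` at the centre, is the sum of that series; Cauchy's estimates hold for `b`. -/
theorem hasSum_of_isBigO_sub_sum {g : ℂ → ℂ} {r M : ℝ} (hr : 0 < r)
    (hg : DifferentiableOn ℂ g (Metric.closedBall 0 r))
    (hM : ∀ t ∈ Metric.closedBall (0 : ℂ) r, ‖g t‖ ≤ M) {b : ℕ → ℂ}
    (hb : ∀ N, (fun t => g t - ∑ k ∈ Finset.range N, b k * t ^ k) =O[𝓝 0] fun t => ‖t‖ ^ N) :
    (∀ k, ‖b k‖ * r ^ k ≤ M) ∧ ∀ t ∈ Metric.ball (0 : ℂ) r, HasSum (fun k => b k * t ^ k) (g t) := by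
  lift r to NNReal using hr.le
  have hp := hg.hasFPowerSeriesOnBall (by exact_mod_cast hr)
  set p := cauchyPowerSeries g 0 r
  have hbp (k : ℕ) : b k = p.coeff k := by
    induction k using Nat.strong_induction_on with
    | _ k ih =>
      rw [← sub_eq_zero]
      refine eq_zero_of_mul_pow_isBigO (k := k) ?_
      -- Both partial sums approximate `g` to order `k + 1` and agree below `k` by induction, so
      -- only the `k`-th terms remain.
      refine ((hp.hasFPowerSeriesAt.isBigO_sub_partialSum_pow (k + 1)).sub
        (hb (k + 1))).congr_left fun t => ?_
      simp only [zero_add, FormalMultilinearSeries.partialSum,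
        FormalMultilinearSeries.apply_eq_pow_smul_coeff, smul_eq_mul, Finset.sum_range_succ]
      rw [Finset.sum_congr rfl fun j hj => by rw [mul_comm, ← ih j (Finset.mem_range.1 hj)]]
      ring
  constructor
  · intro k
    have h1 := Complex.norm_iteratedDeriv_le_of_forall_mem_sphere_norm_le k hr
      (hg.diffContOnCl_ball subset_rfl) fun t ht => hM t (Metric.sphere_subset_closedBall ht)
    have h2 : iteratedDeriv k g 0 = (k.factorial : ℂ) * b k := by
      rw [iteratedDeriv_eq_iteratedFDeriv, ← hp.factorial_smul, hbp, nsmul_eq_mul]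
      simp
    rw [h2, norm_mul, Complex.norm_natCast, mul_div_assoc] at h1
    exact (le_div_iff₀ (by positivity)).1
      (le_of_mul_le_mul_left h1 (by exact_mod_cast k.factorial_pos))
  · intro t ht
    have := hp.hasSum (y := t) (by simpa using ht)
    simpa [hbp, mul_comm] using this

theorem sum_fin_pow_of_isPrimitiveRoot {L : ℕ} {ζ : ℂ} (hζ : IsPrimitiveRoot ζ L) {a b : ℕ}
    (ha : a < L) (hb : b < L) :
    ∑ k ∈ Finset.range L, ((ζ ^ k) ^ a)⁻¹ * (ζ ^ k) ^ b = if b = a then (L : ℂ) else 0 := by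
  have hL : L ≠ 0 := by omega
  have hζ0 : ζ ≠ 0 := hζ.ne_zero hL
  have h1 (k : ℕ) : ((ζ ^ k) ^ a)⁻¹ * (ζ ^ k) ^ b = (ζ ^ b / ζ ^ a) ^ k := by
    rw [div_pow, ← pow_mul, ← pow_mul, ← pow_mul, ← pow_mul, mul_comm a, mul_comm b, div_eq_inv_mul]
  simp only [h1]
  split_ifs with h
  · subst h
    simp [div_self (pow_ne_zero b hζ0)]
  · have hne : ζ ^ b / ζ ^ a ≠ 1 := fun h2 => h (hζ.pow_inj hb ha
      ((div_eq_one_iff_eq (pow_ne_zero a hζ0)).1 h2))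
    rw [geom_sum_eq hne, div_pow, ← pow_mul, ← pow_mul, mul_comm a, mul_comm b, pow_mul, pow_mul,
      hζ.pow_eq_one]
    simp

/-- A polynomial bounded by `M` on a torus has all its monomials bounded by `M` there. -/
theorem norm_monomial_le_of_forall_torus {n : ℕ} (A : Finset (Fin n →₀ ℕ))
    (c : (Fin n →₀ ℕ) → ℂ) (x : Fin n → ℂ) {M : ℝ}
    (hM : ∀ u : Fin n → ℂ, (∀ j, ‖u j‖ = 1) → ‖∑ β ∈ A, c β * ∏ j, (u j * x j) ^ β j‖ ≤ M)
    {α : Fin n →₀ ℕ} (hα : α ∈ A) : ‖c α * ∏ j, x j ^ α j‖ ≤ M := by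
  -- `L` exceeds every exponent in `A`, so the `L`-th roots of unity distinguish all the monomials.
  set L : ℕ := A.sup Finsupp.degree + 1 with hL
  have hlt {β} (hβ : β ∈ A) (j : Fin n) : β j < L :=
    Nat.lt_succ_of_le ((Finsupp.le_degree j β).trans (Finset.le_sup (f := Finsupp.degree) hβ))
  have hL0 : L ≠ 0 := by omega
  have hζ := Complex.isPrimitiveRoot_exp L hL0
  set ζ := Complex.exp (2 * Real.pi * Complex.I / L)
  have hζ1 : ‖ζ‖ = 1 := hζ.norm'_eq_one hL0
  set K : Finset (Fin n → ℕ) := Fintype.piFinset fun _ => Finset.range L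
  have hK : K.card = L ^ n := by simp [K]
  have horth {β} (hβ : β ∈ A) :
      ∑ k ∈ K, ∏ j, (((ζ ^ k j) ^ α j)⁻¹ * (ζ ^ k j) ^ β j) = if β = α then (L : ℂ) ^ n else 0 := by
    rw [← Finset.prod_univ_sum (fun _ => Finset.range L)
      (fun j k => ((ζ ^ k) ^ α j)⁻¹ * (ζ ^ k) ^ β j)]
    rw [Finset.prod_congr rfl fun j _ => sum_fin_pow_of_isPrimitiveRoot hζ (hlt hα j) (hlt hβ j)]
    split_ifs with h
    · subst h
      simp
    · obtain ⟨j, hj⟩ := DFunLike.ne_iff.1 h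
      exact Finset.prod_eq_zero (Finset.mem_univ j) (if_neg hj)
  have havg : (L : ℂ) ^ n * (c α * ∏ j, x j ^ α j) = ∑ k ∈ K, (∏ j, ((ζ ^ k j) ^ α j)⁻¹) *
      ∑ β ∈ A, c β * ∏ j, (ζ ^ k j * x j) ^ β j := by
    simp only [Finset.mul_sum]
    rw [Finset.sum_comm]
    have h1 (β) (hβ : β ∈ A) : ∑ k ∈ K, (∏ j, ((ζ ^ k j) ^ α j)⁻¹) *
        (c β * ∏ j, (ζ ^ k j * x j) ^ β j) =
        if β = α then (L : ℂ) ^ n * (c α * ∏ j, x j ^ α j) else 0 := by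
      have h2 (k : Fin n → ℕ) : (∏ j, ((ζ ^ k j) ^ α j)⁻¹) * (c β * ∏ j, (ζ ^ k j * x j) ^ β j) =
          (∏ j, (((ζ ^ k j) ^ α j)⁻¹ * (ζ ^ k j) ^ β j)) * (c β * ∏ j, x j ^ β j) := by
        simp only [mul_pow, Finset.prod_mul_distrib]
        ring
      rw [Finset.sum_congr rfl fun k _ => h2 k, ← Finset.sum_mul, horth hβ]
      split_ifs with h
      · rw [h]
      · rw [zero_mul]
    rw [Finset.sum_congr rfl h1, Finset.sum_ite_eq' A α, if_pos hα]
  have hle : ‖(L : ℂ) ^ n * (c α * ∏ j, x j ^ α j)‖ ≤ (L : ℝ) ^ n * M := by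
    rw [havg]
    refine (norm_sum_le_of_le K fun k _ => (?_ : _ ≤ M)).trans_eq (by simp [hK])
    rw [norm_mul, norm_prod]
    simp only [norm_inv, norm_pow, hζ1, one_pow, inv_one, Finset.prod_const_one, one_mul]
    exact hM _ fun j => by rw [norm_pow, hζ1, one_pow]
  rw [norm_mul, norm_pow, Complex.norm_natCast] at hle
  exact le_of_mul_le_mul_left hle (by positivity)

theorem summable_pow_degree (n : ℕ) {x : ℝ} (hx0 : 0 ≤ x) (hx1 : x < 1) :
    Summable fun α : Fin n →₀ ℕ => x ^ α.degree := by
  refine summable_of_sum_le (c := ((1 - x)⁻¹) ^ n) (fun α => by positivity) fun u => ?_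
  set L : ℕ := u.sup Finsupp.degree + 1 with hL
  have hlt {β} (hβ : β ∈ u) (j : Fin n) : β j < L :=
    Nat.lt_succ_of_le ((Finsupp.le_degree j β).trans (Finset.le_sup (f := Finsupp.degree) hβ))
  calc ∑ α ∈ u, x ^ α.degree = ∑ f ∈ u.image (fun α : Fin n →₀ ℕ => (α : Fin n → ℕ)),
        ∏ j, x ^ f j := by
        rw [Finset.sum_image fun _ _ _ _ h => DFunLike.coe_injective h]
        simp [Finsupp.degree_eq_sum, Finset.prod_pow_eq_pow_sum]
    _ ≤ ∑ f ∈ Fintype.piFinset fun _ : Fin n => Finset.range L, ∏ j, x ^ f j := by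
        refine Finset.sum_le_sum_of_subset_of_nonneg ?_ fun f _ _ => by positivity
        intro f hf
        obtain ⟨α, hα, rfl⟩ := Finset.mem_image.1 hf
        simpa using hlt hα
    _ = (∑ k ∈ Finset.range L, x ^ k) ^ n := by
        rw [← Finset.prod_univ_sum (fun _ => Finset.range L) (fun _ k => x ^ k)]
        simp
    _ ≤ _ := by
        refine pow_le_pow_left₀ (Finset.sum_nonneg fun k _ => by positivity) ?_ n
        rw [← tsum_geometric_of_lt_one hx0 hx1]
        exact (summable_geometric_of_lt_one hx0 hx1).sum_le_tsum _ fun k _ => by positivity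

theorem MvPowerSeries.homogeneousEval_smul {n : ℕ} (s : MvPowerSeries (Fin n) ℂ) (m : ℕ) (t : ℂ)
    (x : Fin n → ℂ) : s.homogeneousEval m (t • x) = s.homogeneousEval m x * t ^ m := by
  rw [homogeneousEval, homogeneousEval, Finset.sum_mul]
  refine Finset.sum_congr rfl fun α hα => ?_
  rw [← mem_finsuppAntidiag_univ.1 hα, Finsupp.degree_eq_sum, ← Finset.prod_pow_eq_pow_sum]
  simp only [Pi.smul_apply, smul_eq_mul, mul_pow, Finset.prod_mul_distrib]
  ring

theorem HasSum.tendsto_sum_finsuppAntidiag {n : ℕ} {u : (Fin n →₀ ℕ) → ℂ} {S : ℂ}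
    (hu : HasSum u S) :
    Tendsto (fun N => ∑ m ∈ Finset.range N, ∑ α ∈ Finset.finsuppAntidiag Finset.univ m, u α) atTop
      (𝓝 S) := by
  set B : ℕ → Finset (Fin n →₀ ℕ) := fun N =>
    (Finset.range N).biUnion fun m => Finset.finsuppAntidiag Finset.univ m with hB
  have hBmem (N : ℕ) (α : Fin n →₀ ℕ) : α ∈ B N ↔ α.degree < N := by
    simp only [hB, Finset.mem_biUnion, mem_finsuppAntidiag_univ, Finset.mem_range]
    exact ⟨fun ⟨_, h1, h2⟩ => h2 ▸ h1, fun h => ⟨_, h, rfl⟩⟩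
  have hBtend : Tendsto B atTop atTop := by
    refine tendsto_atTop_finset_of_monotone (fun N N' h α hα => ?_)
      fun α => ⟨α.degree + 1, (hBmem _ _).2 (Nat.lt_succ_self _)⟩
    exact (hBmem _ _).2 (lt_of_lt_of_le ((hBmem _ _).1 hα) h)
  refine (hu.comp hBtend).congr fun N => ?_
  rw [Function.comp_apply, Finset.sum_biUnion fun a _ b _ hab => ?_]
  refine Finset.disjoint_left.2 fun α ha hb => hab ?_
  rw [← mem_finsuppAntidiag_univ.1 ha, ← mem_finsuppAntidiag_univ.1 hb]

theorem exists_one_lt_mul_lt {a r : ℝ} (ha : 0 ≤ a) (har : a < r) : ∃ σ, 1 < σ ∧ σ * a < r := by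
  refine ⟨1 + (r - a) / (2 * r), ?_, ?_⟩
  · have : 0 < (r - a) / (2 * r) := div_pos (by linarith) (by linarith)
    linarith
  · have h1 : (r - a) / (2 * r) * a = (r - a) / 2 * (a / r) := by
      have : r ≠ 0 := by linarith
      field_simp
    have h2 : a / r < 1 := (div_lt_one (by linarith)).2 har
    rw [add_mul, h1]
    nlinarith

namespace HasExpansion

variable {n : ℕ} {f : EuclideanSpace ℂ (Fin n) → ℂ} {s : MvPowerSeries (Fin n) ℂ} {r C : ℝ}

/-- On the line through `z`, the homogeneous components of `s` at `z` are the one-variable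
coefficients of `t ↦ f (t • z)`. -/
theorem homogeneousEval_of_slices (hf : HasExpansion f s) (hC : ∀ z ∈ Metric.ball 0 r, ‖f z‖ ≤ C)
    (hd : ∀ z : EuclideanSpace ℂ (Fin n),
      DifferentiableOn ℂ (fun t : ℂ => f (t • z)) {t | t • z ∈ Metric.ball 0 r})
    {z : EuclideanSpace ℂ (Fin n)} (hz : z ∈ Metric.ball 0 r) :
    (∀ m, ‖s.homogeneousEval m z.ofLp‖ ≤ C) ∧
      HasSum (fun m => s.homogeneousEval m z.ofLp) (f z) := by
  rw [mem_ball_zero_iff] at hz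
  -- A disc of radius `σ > 1` leaves `t = 1` in its interior, where the series is evaluated.
  obtain ⟨σ, hσ1, hσ⟩ := exists_one_lt_mul_lt (norm_nonneg z) hz
  have hsub : Metric.closedBall (0 : ℂ) σ ⊆ {t | t • z ∈ Metric.ball 0 r} := fun t ht => by
    rw [mem_closedBall_zero_iff] at ht
    rw [Set.mem_ofPred_eq, mem_ball_zero_iff, norm_smul]
    exact (mul_le_mul_of_nonneg_right ht (norm_nonneg z)).trans_lt hσ
  have htend : Tendsto (fun t : ℂ => t • z) (𝓝 0) (𝓝 0) := by
    have : Continuous fun t : ℂ => t • z := by fun_prop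
    simpa using this.tendsto 0
  obtain ⟨h1, h2⟩ := hasSum_of_isBigO_sub_sum (by linarith) ((hd z).mono hsub)
    (fun t ht => hC _ (hsub ht)) (b := fun m => s.homogeneousEval m z.ofLp) fun N => by
      refine (((hf N).comp_tendsto htend).congr_left fun t => ?_).trans ?_
      · simp only [Function.comp_apply, MvPowerSeries.eval_truncTotal, WithLp.ofLp_smul,
          MvPowerSeries.homogeneousEval_smul]
      · refine IsBigO.of_bound (‖z‖ ^ N) (Eventually.of_forall fun t => ?_)
        simp only [Function.comp_apply, norm_smul, mul_pow, norm_mul, norm_pow, norm_norm]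
        rw [mul_comm]
  constructor
  · intro m
    refine le_trans ?_ (h1 m)
    exact le_mul_of_one_le_right (norm_nonneg _) (one_le_pow₀ hσ1.le)
  · simpa using h2 1 (by simpa using hσ1)

/-- A bounded function on a ball that is holomorphic on slices and has an asymptotic expansion
at the centre is the sum of its multiple power series, absolutely convergent on the ball. -/
theorem hasSum_of_slices (hf : HasExpansion f s) (hC : ∀ z ∈ Metric.ball 0 r, ‖f z‖ ≤ C)
    (hd : ∀ z : EuclideanSpace ℂ (Fin n),
      DifferentiableOn ℂ (fun t : ℂ => f (t • z)) {t | t • z ∈ Metric.ball 0 r})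
    {z : EuclideanSpace ℂ (Fin n)} (hz : z ∈ Metric.ball 0 r) :
    HasSum (fun α : Fin n →₀ ℕ => s.coeff α * ∏ j, z j ^ α j) (f z) := by
  have hz' := mem_ball_zero_iff.1 hz
  obtain ⟨σ, hσ1, hσ⟩ := exists_one_lt_mul_lt (norm_nonneg z) hz'
  have hσ0 : 0 < σ := by linarith
  -- The component bound is applied at `σ z`; rotating its coordinates preserves the Euclidean norm,
  -- so the whole torus lies in the ball.
  have hle (α : Fin n →₀ ℕ) : ‖s.coeff α * ∏ j, z j ^ α j‖ ≤ C * σ⁻¹ ^ α.degree := by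
    have h1 := norm_monomial_le_of_forall_torus (Finset.finsuppAntidiag Finset.univ α.degree)
      (fun β => s.coeff β) ((σ : ℂ) • z.ofLp) (M := C) (fun u hu => by
        refine (hf.homogeneousEval_of_slices hC hd
          (z := WithLp.toLp 2 fun j => u j * ((σ : ℂ) • z.ofLp) j) ?_).1 α.degree
        rw [mem_ball_zero_iff]
        refine lt_of_eq_of_lt ?_ hσ
        rw [← abs_of_pos hσ0, ← Real.norm_eq_abs, ← Complex.norm_real, ← norm_smul,
          EuclideanSpace.norm_eq, EuclideanSpace.norm_eq]
        simp [hu]) (mem_finsuppAntidiag_univ.2 rfl)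
    have h2 : ∏ j, ((σ : ℂ) • z.ofLp) j ^ α j = (σ : ℂ) ^ α.degree * ∏ j, z j ^ α j := by
      rw [Finsupp.degree_eq_sum, ← Finset.prod_pow_eq_pow_sum, ← Finset.prod_mul_distrib]
      simp [mul_pow]
    rw [h2, mul_left_comm, norm_mul, norm_pow, Complex.norm_real, Real.norm_of_nonneg hσ0.le] at h1
    rwa [inv_pow, ← div_eq_mul_inv, le_div_iff₀ (by positivity), mul_comm]
  have hsum : Summable fun α : Fin n →₀ ℕ => s.coeff α * ∏ j, z j ^ α j :=
    Summable.of_norm_bounded ((summable_pow_degree n (by positivity)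
      (inv_lt_one_of_one_lt₀ hσ1)).mul_left C) hle
  have h3 : ∑' α : Fin n →₀ ℕ, s.coeff α * ∏ j, z j ^ α j = f z :=
    tendsto_nhds_unique hsum.hasSum.tendsto_sum_finsuppAntidiag
      (hf.homogeneousEval_of_slices hC hd hz).2.tendsto_sum_nat
  exact h3 ▸ hsum.hasSum

end HasExpansion

/-! ### Analyticity of sums of multiple power series. -/

theorem exists_continuousMultilinearMap_prod_pow {n : ℕ} (α : Fin n →₀ ℕ) :
    ∃ p : (Fin n → ℂ)[×α.degree]→L[ℂ] ℂ, ‖p‖ ≤ 1 ∧ ∀ x, p (fun _ => x) = ∏ j, x j ^ α j := by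
  have hl : (Finsupp.toMultiset α).toList.length = α.degree := by
    rw [Multiset.length_toList, Finsupp.card_toMultiset, Finsupp.degree_eq_sum]
    exact Finsupp.sum_fintype _ _ fun _ => rfl
  rw [← hl]
  refine ⟨(ContinuousMultilinearMap.mkPiAlgebra ℂ _ ℂ).compContinuousLinearMap fun i =>
    ContinuousLinearMap.proj ((Finsupp.toMultiset α).toList[i.1]), ?_, fun x => ?_⟩
  · refine ContinuousMultilinearMap.opNorm_le_bound zero_le_one fun v => ?_
    simp only [ContinuousMultilinearMap.compContinuousLinearMap_apply,
      ContinuousMultilinearMap.mkPiAlgebra_apply, ContinuousLinearMap.proj_apply, norm_prod, one_mul]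
    exact Finset.prod_le_prod (fun _ _ => norm_nonneg _) fun i _ => norm_le_pi_norm (v i) _
  · simp only [ContinuousMultilinearMap.compContinuousLinearMap_apply,
      ContinuousMultilinearMap.mkPiAlgebra_apply, ContinuousLinearMap.proj_apply]
    rw [Fin.prod_univ_fun_getElem, ← Multiset.prod_coe, ← Multiset.map_coe, Multiset.coe_toList,
      Finsupp.toMultiset_map, Finsupp.prod_toMultiset,
      Finsupp.prod_mapDomain_index (fun _ => pow_zero _) (fun _ _ _ => pow_add _ _ _),
      Finsupp.prod_fintype _ _ fun _ => pow_zero _]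

theorem exists_continuousMultilinearMap_sum {n m : ℕ} (c : (Fin n →₀ ℕ) → ℂ)
    (A : Finset (Fin n →₀ ℕ)) (hA : ∀ α ∈ A, α.degree = m) :
    ∃ p : (Fin n → ℂ)[×m]→L[ℂ] ℂ, ‖p‖ ≤ ∑ α ∈ A, ‖c α‖ ∧
      ∀ x, p (fun _ => x) = ∑ α ∈ A, c α * ∏ j, x j ^ α j := by
  induction A using Finset.cons_induction with
  | empty => exact ⟨0, by simp, by simp⟩
  | cons α A hα ih =>
    obtain ⟨p, hp, hpx⟩ := ih fun β hβ => hA β (Finset.mem_cons_of_mem hβ)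
    obtain rfl := hA α (Finset.mem_cons_self _ _)
    obtain ⟨q, hq, hqx⟩ := exists_continuousMultilinearMap_prod_pow α
    refine ⟨c α • q + p, ?_, fun x => ?_⟩
    · rw [Finset.sum_cons]
      refine (norm_add_le _ _).trans (add_le_add ?_ hp)
      rw [norm_smul]
      exact mul_le_of_le_one_right (norm_nonneg _) hq
    · rw [Finset.sum_cons, ← hpx, ← hqx]
      rfl

/-- The sum of a multiple power series with absolutely summable coefficients is analytic on the
open unit polydisc. -/
theorem analyticOnNhd_polydisc_of_hasSum {n : ℕ} {c : (Fin n →₀ ℕ) → ℂ}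
    (hc : Summable fun α => ‖c α‖) {f : (Fin n → ℂ) → ℂ}
    (hf : ∀ x ∈ Metric.ball (0 : Fin n → ℂ) 1, HasSum (fun α => c α * ∏ j, x j ^ α j) (f x)) :
    AnalyticOnNhd ℂ f (Metric.ball 0 1) := by
  choose p hp hpx using fun m => exists_continuousMultilinearMap_sum c
    (Finset.finsuppAntidiag Finset.univ m) fun α hα => mem_finsuppAntidiag_univ.1 hα
  have hpK (m : ℕ) : ‖p m‖ ≤ ∑' α, ‖c α‖ :=
    (hp m).trans (hc.sum_le_tsum _ fun _ _ => norm_nonneg _)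
  have hfp : HasFPowerSeriesOnBall f p 0 1 :=
    { r_le := by
        simpa using FormalMultilinearSeries.le_radius_of_bound p (∑' α, ‖c α‖) (r := 1)
          fun m => by simpa using hpK m
      r_pos := one_pos
      hasSum := fun {y} hy => by
        have hy1 : ‖y‖ < 1 := by
          have := hy
          rw [← ENNReal.ofReal_one, Metric.eball_ofReal, mem_ball_zero_iff] at this
          exact this
        have hs : Summable fun m => p m fun _ => y :=
          Summable.of_norm_bounded
            ((summable_geometric_of_lt_one (norm_nonneg y) hy1).mul_left (∑' α, ‖c α‖)) fun m => by
              refine ((p m).le_opNorm _).trans ?_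
              simp only [Finset.prod_const, Finset.card_univ, Fintype.card_fin]
              exact mul_le_mul_of_nonneg_right (hpK m) (by positivity)
        have h1 := (hf y (by simpa using hy1)).tendsto_sum_finsuppAntidiag
        simp only [← hpx] at h1
        rw [zero_add, ← tendsto_nhds_unique hs.hasSum.tendsto_sum_nat h1]
        exact hs.hasSum }
  have := hfp.analyticOnNhd
  rwa [← ENNReal.ofReal_one, Metric.eball_ofReal] at this

/-- Enlarging all moduli `‖w j‖` by a small `δ > 0` keeps the vector of radii in the ball: `w` lies
in an open polydisc whose closure stays inside. -/
theorem exists_radii_of_mem_ball {n : ℕ} {r : ℝ} {w : EuclideanSpace ℂ (Fin n)}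
    (hw : w ∈ Metric.ball 0 r) : ∃ ρ : Fin n → ℝ, (∀ j, ‖w j‖ < ρ j) ∧
      ‖(WithLp.toLp 2 fun j => (ρ j : ℂ) : EuclideanSpace ℂ (Fin n))‖ < r := by
  have hcont : Continuous fun δ : ℝ =>
      ‖(WithLp.toLp 2 fun j => ((‖w j‖ + δ : ℝ) : ℂ) : EuclideanSpace ℂ (Fin n))‖ := by
    fun_prop
  have h0 : ‖(WithLp.toLp 2 fun j => ((‖w j‖ + (0 : ℝ) : ℝ) : ℂ) :
      EuclideanSpace ℂ (Fin n))‖ < r := by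
    rw [mem_ball_zero_iff] at hw
    simpa [EuclideanSpace.norm_eq] using hw
  obtain ⟨δ, hδ, hδ0⟩ := (((hcont.tendsto 0).eventually_lt_const h0).filter_mono
    (nhdsWithin_le_nhds (s := Set.Ioi 0)) |>.and self_mem_nhdsWithin).exists
  exact ⟨_, fun j => lt_add_of_pos_right _ hδ0, hδ⟩

/-- The sum of a multiple power series that converges on a Euclidean ball is analytic there. -/
theorem analyticOnNhd_ball_of_hasSum {n : ℕ} {c : (Fin n →₀ ℕ) → ℂ} {r : ℝ}
    {f : EuclideanSpace ℂ (Fin n) → ℂ}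
    (hf : ∀ z ∈ Metric.ball (0 : EuclideanSpace ℂ (Fin n)) r,
      HasSum (fun α => c α * ∏ j, z j ^ α j) (f z)) :
    AnalyticOnNhd ℂ f (Metric.ball 0 r) := by
  intro w hw
  obtain ⟨ρ, hwρ, hρ⟩ := exists_radii_of_mem_ball hw
  have hρ0 (j : Fin n) : 0 < ρ j := (norm_nonneg _).trans_lt (hwρ j)
  have hscale (x : Fin n → ℂ) (hx : ∀ j, ‖x j‖ ≤ 1) :
      (WithLp.toLp 2 fun j => (ρ j : ℂ) * x j) ∈
        Metric.ball (0 : EuclideanSpace ℂ (Fin n)) r := by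
    rw [mem_ball_zero_iff]
    refine lt_of_le_of_lt ?_ hρ
    rw [EuclideanSpace.norm_eq, EuclideanSpace.norm_eq]
    refine Real.sqrt_le_sqrt (Finset.sum_le_sum fun j _ => ?_)
    simp only [norm_mul]
    gcongr
    exact mul_le_of_le_one_right (norm_nonneg _) (hx j)
  have hprod (α : Fin n →₀ ℕ) (x : Fin n → ℂ) : c α * (∏ j, (ρ j : ℂ) ^ α j) * ∏ j, x j ^ α j =
      c α * ∏ j, ((ρ j : ℂ) * x j) ^ α j := by
    simp only [mul_pow, Finset.prod_mul_distrib]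
    ring
  have hsum (x : Fin n → ℂ) (hx : ∀ j, ‖x j‖ ≤ 1) :
      HasSum (fun α : Fin n →₀ ℕ => c α * (∏ j, (ρ j : ℂ) ^ α j) * ∏ j, x j ^ α j)
        (f (WithLp.toLp 2 fun j => (ρ j : ℂ) * x j)) := by
    have := hf (WithLp.toLp 2 fun j => (ρ j : ℂ) * x j) (hscale x hx)
    simpa only [hprod] using this
  -- Evaluating at `x = (1, …, 1)`, the corner of the rescaled polydisc, gives absolute summability
  -- of the rescaled coefficients.
  have hnorm : Summable fun α : Fin n →₀ ℕ => ‖c α * ∏ j, (ρ j : ℂ) ^ α j‖ := by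
    refine (hsum (fun _ => 1) (by simp)).summable.norm.congr fun α => ?_
    simp only [one_pow, Finset.prod_const_one, mul_one]
  have hg := analyticOnNhd_polydisc_of_hasSum hnorm fun x hx =>
    hsum x fun j => (norm_le_pi_norm x j).trans (mem_ball_zero_iff.1 hx).le
  set ℓ : EuclideanSpace ℂ (Fin n) →L[ℂ] (Fin n → ℂ) :=
    ContinuousLinearMap.pi fun j => ((ρ j : ℂ)⁻¹) • EuclideanSpace.proj j with hℓ
  have hℓw : ℓ w ∈ Metric.ball (0 : Fin n → ℂ) 1 := by
    rw [mem_ball_zero_iff, pi_norm_lt_iff one_pos]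
    intro j
    simp only [hℓ, ContinuousLinearMap.pi_apply, smul_apply,
      PiLp.proj_apply, norm_smul, norm_inv, Complex.norm_real,
      Real.norm_of_nonneg (hρ0 j).le]
    rw [inv_mul_lt_one₀ (hρ0 j)]
    exact hwρ j
  have := (hg _ hℓw).comp (ℓ.analyticAt w)
  refine this.congr (Eventually.of_forall fun z => ?_)
  simp only [Function.comp_apply]
  congr 1
  ext j
  simp [hℓ, mul_inv_cancel_left₀ (Complex.ofReal_ne_zero.2 (hρ0 j).ne')]

/-! ### Convergence of the formal solution. -/

/-- On each ball of radius `r < 1` the formal solution converges, to an analytic function. -/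
theorem exists_hasSum_of_isFormalSchroederSolution {n : ℕ}
    {φ : EuclideanSpace ℂ (Fin n) → EuclideanSpace ℂ (Fin n)}
    (hφ : AnalyticOnNhd ℂ φ (Metric.ball 0 1))
    (hmaps : Set.MapsTo φ (Metric.ball 0 1) (Metric.ball 0 1)) (hzero : φ 0 = 0)
    (hdet : (jacobianAtZero φ).det ≠ 0) (hslice : ∀ ζ, ¬ IsUnitaryOnSlice φ ζ)
    {F : Fin n → MvPowerSeries (Fin n) ℂ} (hF : IsFormalSchroederSolution φ F)
    {r : ℝ} (hr0 : 0 < r) (hr1 : r < 1) :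
    ∃ f : EuclideanSpace ℂ (Fin n) → Fin n → ℂ, ∀ z ∈ Metric.ball 0 r, ∀ i,
      HasSum (fun α : Fin n →₀ ℕ => (F i).coeff α * ∏ j, z j ^ α j) (f z i) := by
  obtain ⟨c, hc0, hc1, hc⟩ := exists_norm_le_mul_norm_of_not_isUnitaryOnSlice hφ.differentiableOn
    hmaps hzero hslice hr0 hr1
  set J := jacobianAtZero φ with hJ
  have hPd (P : MvPolynomial (Fin n) ℂ) :
      Differentiable ℂ fun z : EuclideanSpace ℂ (Fin n) => MvPolynomial.eval z.ofLp P := by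
    simp only [MvPolynomial.eval_eq']
    fun_prop
  obtain ⟨f, ⟨C, hfC⟩, hfd, hf⟩ := exists_linearization
    (W := Fin n → ℂ) (A := LinearMap.toContinuousLinearMap J.mulVecLin)
    (B := LinearMap.toContinuousLinearMap J⁻¹.mulVecLin)
    (P := fun N z i => MvPolynomial.eval z.ofLp ((F i).truncTotal N)) hr0
    (hφ.differentiableOn.mono (Metric.ball_subset_ball hr1.le)) hc0 hc1 hc
    (fun w => by
      simp [Matrix.mulVec_mulVec, Matrix.nonsing_inv_mul _ (isUnit_iff_ne_zero.2 hdet)])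
    (fun N => differentiable_pi.2 fun i => hPd _)
    (fun N => isBigO_pi.2 fun i => by
      simpa [Matrix.mulVec, dotProduct] using
        hF.isBigO (hφ 0 (by simp)) hzero N i)
    (fun M N hMN => isBigO_pi.2 fun i => by
      simp only [Pi.sub_apply, ← map_sub]
      refine MvPolynomial.isBigO_eval _ fun α hα => ?_
      rw [MvPolynomial.coeff_sub, MvPowerSeries.coeff_truncTotal _ hα,
        MvPowerSeries.coeff_truncTotal _ (hα.trans_le hMN), sub_self])
  refine ⟨f, fun z hz i => HasExpansion.hasSum_of_slices (f := fun z => f z i) (fun N => ?_)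
    (fun w hw => (norm_le_pi_norm (f w) i).trans (hfC w hw))
    (fun w => differentiableOn_pi.1 (hfd w) i) hz⟩
  exact isBigO_pi.1 (hf N) i

theorem mainTheorem5 (n : ℕ)
    (φ : EuclideanSpace ℂ (Fin n) → EuclideanSpace ℂ (Fin n))
    (hφ : AnalyticOnNhd ℂ φ (Metric.ball 0 1))
    (hmaps : Set.MapsTo φ (Metric.ball 0 1) (Metric.ball 0 1))
    (hzero : φ 0 = 0)
    (hdet : (jacobianAtZero φ).det ≠ 0)
    (hslice : ∀ ζ : EuclideanSpace ℂ (Fin n), ¬ IsUnitaryOnSlice φ ζ)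
    (F : Fin n → MvPowerSeries (Fin n) ℂ)
    (hF : IsFormalSchroederSolution φ F) :
    ∃ f : EuclideanSpace ℂ (Fin n) → EuclideanSpace ℂ (Fin n),
      AnalyticOnNhd ℂ f (Metric.ball 0 1) ∧
      ∀ z ∈ Metric.ball (0 : EuclideanSpace ℂ (Fin n)) 1, ∀ i : Fin n,
        HasSum (fun α : Fin n →₀ ℕ => MvPowerSeries.coeff α (F i) * ∏ j, z j ^ α j) (f z i) := by
  have hsum (z) (hz : z ∈ Metric.ball (0 : EuclideanSpace ℂ (Fin n)) 1) (i : Fin n) :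
      Summable fun α : Fin n →₀ ℕ => MvPowerSeries.coeff α (F i) * ∏ j, z j ^ α j := by
    rw [mem_ball_zero_iff] at hz
    obtain ⟨r, hzr, hr1⟩ := exists_between hz
    obtain ⟨f, hf⟩ := exists_hasSum_of_isFormalSchroederSolution hφ hmaps hzero hdet hslice hF
      ((norm_nonneg z).trans_lt hzr) hr1
    exact (hf z (mem_ball_zero_iff.2 hzr) i).summable
  -- The sum of the series itself does not involve `r`, so nothing has to be glued.
  refine ⟨fun z => WithLp.toLp 2 fun i =>
    ∑' α : Fin n →₀ ℕ, MvPowerSeries.coeff α (F i) * ∏ j, z j ^ α j, fun z hz => ?_,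
    fun z hz i => (hsum z hz i).hasSum⟩
  exact ((EuclideanSpace.equiv (Fin n) ℂ).symm.analyticAt _).comp (analyticAt_pi_iff.2 fun i =>
    analyticOnNhd_ball_of_hasSum (fun w hw => (hsum w hw i).hasSum) z hz)
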